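/- Let $P\subset\mathbb{R}^2$ be a convex polygon with $n$ edges, that is, a compact convex set with non-empty interior whose boundary is a closed polygonal curve $v_1v_2\cup v_2v_3\cup\dots\cup v_nv_1$ with $n$ edges. Let $\delta(P)$ be the Euclidean diameter of $P$, let $\varphi=\frac{1+\sqrt5}{2}$ be the golden ratio, and suppose that $\delta(P)>\varphi^{-4}$ (equivalently, that the number $2\lceil\log_\varphi\delta(P)\rceil+7$ is positive; this holds in particular whenever $\delta(P)\ge 1$). Then the discrete hull of $P$, i.e. the convex hull of $P\cap\mathbb{Z}^2$, has finitely many vertices (extreme points), and their number is at most $$\bigl(2\lceil\log_\varphi\delta(P)\rceil+7\bigr)\,n.$$ -/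

import Mathlib

/-- The Euclidean plane. -/
abbrev Plane : Type := EuclideanSpace ℝ (Fin 2)

/-- The planar integer lattice `ℤ × ℤ`. -/
def integerLattice : Set Plane := {x | ∀ i, ∃ k : ℤ, x i = (k : ℝ)}

/-- The discrete hull of a planar set `C`: the convex hull of its lattice points. -/
def discreteHull (C : Set Plane) : Set Plane := convexHull ℝ (C ∩ integerLattice)

/-- The vertices of the discrete hull, i.e. its extreme points. -/
def discreteHullVertices (C : Set Plane) : Set Plane := (discreteHull C).extremePoints ℝ

/-- `P` is a (solid) convex polygon whose edges are the `n` segments `v i, v (i + 1)` (cyclically):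
a planar convex body whose boundary is the closed polygonal curve `v`. Consecutive edges may be
collinear, so that every ordinary convex `n`-gon is covered, with `v` its cyclic sequence of
corners. -/
structure IsConvexPolygon {n : ℕ} (v : Polygon Plane n) (P : Set Plane) : Prop where
  convex : Convex ℝ P
  isCompact : IsCompact P
  interior_nonempty : (interior P).Nonempty
  frontier_eq : frontier P = v.boundary ℝ

/-! Write `P` as an intersection of `n` half-planes with unit normals, and let `h` be the distance
to one bounding line. If `y` is a vertex of the discrete hull and `z` its counterclockwise
successor, the lattice point `2y - z` lies outside `P`, since otherwise `y` would be the midpoint of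
two hull points. So some half-plane excludes it, which says `2 h(y) < h(z)`. Charge `y` to that
half-plane.

It remains to bound the charges to one line (`IsNext.card_le_of_doubling`). By convexity, the height
intervals of ascending hull steps do not overlap (`IsNext.le_of_ascending`). Sorted by height, the
increments `d` therefore satisfy `d (k+2) ≥ d k + d (k+1)`, because doubling makes each increment at
least its starting height. They are at most the diameter `δ`. Two ascending steps are never
parallel, so their integer determinant gives `1 ≤ δ (d 0 + d 1)`. Fibonacci growth from `1/δ` to `δ`
leaves room for at most `2⌈log_φ δ⌉ + 4` steps. The remaining 3 in the constant only serves hulls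
with at most one vertex, where `δ < 1` is possible. -/

open Set

/-- The determinant of two plane vectors. -/
def planeDet (x y : Plane) : ℝ := x 0 * y 1 - x 1 * y 0

theorem exists_apply_eq_coords (f : Plane →L[ℝ] ℝ) :
    ∃ p q : ℝ, ∀ x, f x = p * x 0 + q * x 1 := by
  refine ⟨f (EuclideanSpace.single 0 1), f (EuclideanSpace.single 1 1), fun x => ?_⟩
  have hx : x = x 0 • EuclideanSpace.single (0 : Fin 2) (1 : ℝ) +
      x 1 • EuclideanSpace.single (1 : Fin 2) (1 : ℝ) := by
    ext i; fin_cases i <;> simp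
  conv_lhs => rw [hx]
  simp only [map_add, map_smul, smul_eq_mul]
  ring

theorem plane_dist_sq (x y : Plane) : dist x y ^ 2 = (x 0 - y 0) ^ 2 + (x 1 - y 1) ^ 2 := by
  rw [EuclideanSpace.dist_eq, Real.sq_sqrt (by positivity)]
  simp [Fin.sum_univ_two, Real.dist_eq, sq_abs]

/-! ### Counterclockwise successors among extreme points -/

/-- In a finite set of extreme points, every point has a counterclockwise successor. -/
theorem exists_counterclockwise_next {K S : Set Plane} (hK : Convex ℝ K)
    (hSK : S ⊆ K.extremePoints ℝ) (hS : S.Finite) {y : Plane} (hy : y ∈ S)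
    (hne : ∃ z ∈ S, z ≠ y) :
    ∃ z ∈ S, z ≠ y ∧ ∀ w ∈ S, w ≠ y → w ≠ z → 0 < planeDet (z - y) (w - y) := by
  have hyK : y ∉ convexHull ℝ (S \ {y}) := by
    have hc : Convex ℝ (K \ {y}) := (hK.mem_extremePoints_iff_convex_sdiff.1 (hSK hy)).2
    have hsub : convexHull ℝ (S \ {y}) ⊆ K \ {y} :=
      convexHull_min (fun x hx => ⟨(hSK hx.1).1, hx.2⟩) hc
    exact fun h => (hsub h).2 rfl
  have hfin : (S \ {y}).Finite := hS.subset sdiff_subset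
  obtain ⟨f, u, hfy, hfu⟩ := geometric_hahn_banach_point_closed (convex_convexHull ℝ (S \ {y}))
    (hfin.isCompact_convexHull ℝ).isClosed hyK
  obtain ⟨p, q, hpq⟩ := exists_apply_eq_coords f
  have hpos : ∀ w ∈ S, w ≠ y → 0 < p * (w 0 - y 0) + q * (w 1 - y 1) := by
    intro w hw hwy
    have := hfu w (subset_convexHull ℝ _ ⟨hw, hwy⟩)
    rw [hpq] at this hfy
    linarith
  -- All `w - y` lie in an open half-plane with normal `(p, q)`, so the quotient is the tangent of
  -- the angle from `(p, q)` to `w - y`. The successor is the most clockwise direction.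
  obtain ⟨z, ⟨hzS, hzy⟩, hz⟩ := Set.exists_min_image (S \ {y})
    (fun w => (p * (w 1 - y 1) - q * (w 0 - y 0)) / (p * (w 0 - y 0) + q * (w 1 - y 1))) hfin
    (by obtain ⟨z, hz⟩ := hne; exact ⟨z, hz⟩)
  refine ⟨z, hzS, hzy, fun w hw hwy hwz => ?_⟩
  have hmin := hz w ⟨hw, hwy⟩
  have hzp := hpos z hzS hzy
  have hwp := hpos w hw hwy
  rw [div_le_div_iff₀ hzp hwp] at hmin
  have hr : 0 < p ^ 2 + q ^ 2 := by
    by_contra h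
    have hp : p = 0 := by nlinarith [sq_nonneg p, sq_nonneg q]
    have hq : q = 0 := by nlinarith [sq_nonneg p, sq_nonneg q]
    simp [hp, hq] at hzp
  have hdet : 0 ≤ planeDet (z - y) (w - y) := by
    have : 0 ≤ (p ^ 2 + q ^ 2) * planeDet (z - y) (w - y) := by
      simp only [planeDet, PiLp.sub_apply]
      nlinarith [hmin]
    exact nonneg_of_mul_nonneg_right this hr
  -- Equality would put `z` and `w` on one ray from `y`; the nearer of them would then not be
  -- extreme.
  refine lt_of_le_of_ne hdet fun h0 => ?_
  set s := p * (z 0 - y 0) + q * (z 1 - y 1) with hs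
  set t := p * (w 0 - y 0) + q * (w 1 - y 1) with ht
  -- `z - y` and `w - y` are proportional
  have hprop : ∀ i, s * (w i - y i) = t * (z i - y i) := by
    simp only [planeDet, PiLp.sub_apply] at h0
    intro i
    fin_cases i
    · simp only [hs, ht, Fin.zero_eta]; linear_combination q * h0
    · simp only [hs, ht, Fin.mk_one]; linear_combination (-p) * h0
  rcases lt_trichotomy s t with hst | hst | hst
  · have : z ∈ openSegment ℝ y w := by
      refine ⟨1 - s / t, s / t, ?_, by positivity, by ring, ?_⟩
      · have := (div_lt_one hwp).2 hst
        linarith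
      · ext i
        have := hprop i
        simp only [PiLp.add_apply, PiLp.smul_apply, smul_eq_mul]
        field_simp
        linarith
    exact hwz ((mem_extremePoints.1 (hSK hzS)).2 y (hSK hy).1 w (hSK hw).1 this).2
  · refine hwz (PiLp.ext fun i => ?_)
    have := hprop i
    rw [hst] at this
    have := mul_left_cancel₀ hwp.ne' this
    linarith
  · have : w ∈ openSegment ℝ y z := by
      refine ⟨1 - t / s, t / s, ?_, by positivity, by ring, ?_⟩
      · have := (div_lt_one hzp).2 hst
        linarith
      · ext i
        have := hprop i
        simp only [PiLp.add_apply, PiLp.smul_apply, smul_eq_mul]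
        field_simp
        linarith
    exact hwz ((mem_extremePoints.1 (hSK hw)).2 y (hSK hy).1 z (hSK hzS).1 this).2.symm

/-! ### Fibonacci growth and lattice points -/

theorem goldenRatio_pow_le_fib (n : ℕ) : Real.goldenRatio ^ n ≤ Nat.fib (n + 2) := by
  induction n using Nat.twoStepInduction with
  | zero => simp
  | one => simpa [Nat.fib] using Real.goldenRatio_lt_two.le
  | more n ih1 ih2 =>
    rw [Nat.fib_add_two]
    push_cast
    have := Real.goldenRatio_sq
    calc Real.goldenRatio ^ (n + 2) = Real.goldenRatio ^ n + Real.goldenRatio ^ (n + 1) := by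
          rw [pow_add, this]; ring
      _ ≤ _ := add_le_add ih1 ih2

theorem finite_inter_integerLattice {P : Set Plane} (hP : Bornology.IsBounded P) :
    (P ∩ integerLattice).Finite := by
  obtain ⟨R, hR⟩ := hP.exists_norm_le
  refine ((Set.finite_Icc (fun _ : Fin 2 => -⌈R⌉) (fun _ => ⌈R⌉)).image
    (fun k : Fin 2 → ℤ => (WithLp.toLp 2 fun i => (k i : ℝ) : Plane))).subset ?_
  rintro x ⟨hx, hxZ⟩
  choose k hk using hxZ
  have hb : ∀ i, -⌈R⌉ ≤ k i ∧ k i ≤ ⌈R⌉ := by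
    intro i
    have h1 : |x i| ≤ R := (PiLp.norm_apply_le x i).trans (hR x hx)
    rw [hk, abs_le] at h1
    have := Int.le_ceil R
    constructor
    · have : (-(⌈R⌉ : ℝ)) ≤ k i := by linarith
      exact_mod_cast this
    · have : (k i : ℝ) ≤ (⌈R⌉ : ℝ) := by linarith
      exact_mod_cast this
  exact ⟨k, ⟨fun i => (hb i).1, fun i => (hb i).2⟩, by ext i; simp [hk]⟩

theorem one_le_dist_of_mem_integerLattice {x y : Plane} (hx : x ∈ integerLattice)
    (hy : y ∈ integerLattice) (hxy : x ≠ y) : 1 ≤ dist x y := by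
  have h : 1 ≤ dist x y ^ 2 := by
    rw [plane_dist_sq]
    obtain ⟨i, hi⟩ : ∃ i, x i ≠ y i := by
      by_contra! h; exact hxy (PiLp.ext h)
    obtain ⟨a, ha⟩ := hx i
    obtain ⟨b, hb⟩ := hy i
    have hab : a - b ≠ 0 := fun h => hi (by rw [ha, hb, sub_eq_zero.1 h])
    have h1 : (1 : ℤ) ≤ (a - b) ^ 2 := by
      have := Int.one_le_abs hab
      nlinarith [sq_abs (a - b)]
    have h2 : 1 ≤ (x i - y i) ^ 2 := by
      rw [ha, hb]
      have : ((1 : ℤ) : ℝ) ≤ ((a - b) ^ 2 : ℤ) := Int.cast_le.2 h1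
      push_cast at this
      exact this
    have := sq_nonneg (x 0 - y 0)
    have := sq_nonneg (x 1 - y 1)
    fin_cases i <;> simp only [Fin.zero_eta, Fin.mk_one] at h2 <;> linarith
  nlinarith [dist_nonneg (x := x) (y := y)]

/-! ### Ascending steps of the successor map -/

/-- `next` maps each point of `S` to its counterclockwise successor on the convex hull of `S`. -/
def IsNext (S : Set Plane) (next : Plane → Plane) : Prop :=
  ∀ y ∈ S, next y ∈ S ∧ next y ≠ y ∧
    ∀ w ∈ S, w ≠ y → w ≠ next y → 0 < planeDet (next y - y) (w - y)

theorem IsNext.planeDet_nonneg {S : Set Plane} {next : Plane → Plane} (hnext : IsNext S next)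
    {y w : Plane} (hy : y ∈ S) (hw : w ∈ S) : 0 ≤ planeDet (next y - y) (w - y) := by
  by_cases h1 : w = y
  · simp [h1, planeDet]
  by_cases h2 : w = next y
  · subst h2; simp only [planeDet]; linarith
  · exact ((hnext y hy).2.2 w hw h1 h2).le

/-- Along the steps of `next` which increase an affine function `c - p x₀ - q x₁`, its values
at a later starting point are at least those at an earlier end point. -/
theorem IsNext.le_of_ascending {S : Set Plane} {next : Plane → Plane} (hnext : IsNext S next)
    {p q c : ℝ} {h : Plane → ℝ} (hh : ∀ x, h x = c - (p * x 0 + q * x 1)) {y z : Plane}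
    (hy : y ∈ S) (hz : z ∈ S) (hyz : z ≠ y) (hle : h y ≤ h z)
    (haz : h z < h (next z)) : h (next y) ≤ h z := by
  by_contra! hlt
  have hne : z ≠ next y := fun he => by rw [← he] at hlt; exact lt_irrefl _ hlt
  have h1 := (hnext y hy).2.2 z hz hyz hne
  have h2 := hnext.planeDet_nonneg hz hy
  have h3 := hnext.planeDet_nonneg hz (hnext y hy).1
  simp only [hh] at hle haz hlt
  simp only [planeDet, PiLp.sub_apply] at h1 h2 h3
  generalize next y = y' at *
  generalize next z = z' at *
  -- At the level of `z`, the step from `y` has a point which must lie left of the step from `z`,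
  -- while `z` lies strictly left of the step from `y`. Both steps ascend, so "left" is the same
  -- direction on this level line. Algebraically, the three products sum to zero, though one is
  -- positive and the others nonnegative.
  have e1 := mul_pos (sub_pos.2 haz) h1
  have e2 := mul_nonneg (sub_nonneg.2 hle) h3
  have e3 := mul_nonneg (sub_pos.2 hlt).le h2
  nlinarith

/-- Parallel ascending steps would point the same way, and each would have the other on its left,
one of them strictly. -/
theorem IsNext.planeDet_ne_zero {S : Set Plane} {next : Plane → Plane} (hnext : IsNext S next)
    {p q c : ℝ} {h : Plane → ℝ} (hh : ∀ x, h x = c - (p * x 0 + q * x 1)) {y z : Plane}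
    (hy : y ∈ S) (hz : z ∈ S) (hyz : z ≠ y) (hay : h y < h (next y))
    (haz : h z < h (next z)) : planeDet (next y - y) (next z - z) ≠ 0 := by
  intro h0
  by_cases hne : z = next y
  · have hzy : next z ≠ y := fun he => by rw [he, hne] at haz; exact lt_asymm hay haz
    have := (hnext y hy).2.2 (next z) (hnext z hz).1 hzy (hne ▸ (hnext z hz).2.1)
    rw [← hne] at this h0
    simp only [planeDet, PiLp.sub_apply] at this h0
    linarith
  · have h1 := (hnext y hy).2.2 z hz hyz hne
    have h2 := hnext.planeDet_nonneg hz hy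
    simp only [hh] at hay haz
    simp only [planeDet, PiLp.sub_apply] at h0 h1 h2
    generalize next y = y' at *
    generalize next z = z' at *
    have e1 := mul_pos (sub_pos.2 haz) h1
    have e2 := mul_nonneg (sub_pos.2 hay).le h2
    have e3 : (p * (z 0 - y 0) + q * (z 1 - y 1)) *
      ((y' 0 - y 0) * (z' 1 - z 1) - (y' 1 - y 1) * (z' 0 - z 0)) = 0 := by rw [h0, mul_zero]
    nlinarith

theorem one_le_abs_planeDet {a b c d : Plane} (ha : a ∈ integerLattice) (hb : b ∈ integerLattice)
    (hc : c ∈ integerLattice) (hd : d ∈ integerLattice) (h : planeDet (a - b) (c - d) ≠ 0) :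
    1 ≤ |planeDet (a - b) (c - d)| := by
  choose a' ha using ha
  choose b' hb using hb
  choose c' hc using hc
  choose d' hd using hd
  have : planeDet (a - b) (c - d) =
      (((a' 0 - b' 0) * (c' 1 - d' 1) - (a' 1 - b' 1) * (c' 0 - d' 0) : ℤ) : ℝ) := by
    simp only [planeDet, PiLp.sub_apply, ha, hb, hc, hd]
    push_cast
    ring
  rw [this] at h ⊢
  have := Int.one_le_abs (Int.cast_ne_zero.1 h)
  rw [← Int.cast_abs]
  have : ((1 : ℤ) : ℝ) ≤ _ := Int.cast_le.2 this
  simpa using this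

theorem abs_coord_le_of_dist_le {p q δ : ℝ} (hpq : p ^ 2 + q ^ 2 = 1) {x y : Plane}
    (h : dist x y ≤ δ) : |p * (x 0 - y 0) + q * (x 1 - y 1)| ≤ δ := by
  refine abs_le_of_sq_le_sq (le_trans ?_ (pow_le_pow_left₀ dist_nonneg h 2))
    (dist_nonneg.trans h)
  rw [plane_dist_sq]
  nlinarith [sq_nonneg (p * (x 1 - y 1) - q * (x 0 - y 0))]

/-- Expand the determinant in the orthonormal frame `(p, q)`, `(-q, p)` and bound the tangential
components by `δ`. -/
theorem abs_planeDet_le {p q δ : ℝ} (hpq : p ^ 2 + q ^ 2 = 1) {a b c d : Plane}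
    (hab : dist a b ≤ δ) (hcd : dist c d ≤ δ) :
    |planeDet (a - b) (c - d)| ≤
      δ * (|p * (a 0 - b 0) + q * (a 1 - b 1)| + |p * (c 0 - d 0) + q * (c 1 - d 1)|) := by
  have hpq' : (-q) ^ 2 + p ^ 2 = 1 := by linarith
  have h1 := abs_coord_le_of_dist_le hpq' hab
  have h2 := abs_coord_le_of_dist_le hpq' hcd
  have : planeDet (a - b) (c - d) =
      (p * (a 0 - b 0) + q * (a 1 - b 1)) * (-q * (c 0 - d 0) + p * (c 1 - d 1)) -
      (-q * (a 0 - b 0) + p * (a 1 - b 1)) * (p * (c 0 - d 0) + q * (c 1 - d 1)) := by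
    simp only [planeDet, PiLp.sub_apply]
    linear_combination
      (-((a 0 - b 0) * (c 1 - d 1) - (a 1 - b 1) * (c 0 - d 0))) * hpq
  rw [this]
  refine (abs_sub _ _).trans ?_
  rw [abs_mul, abs_mul, mul_add]
  refine add_le_add ?_ ?_
  · rw [mul_comm]; gcongr
  · gcongr

/-! ### Counting the doubling steps for one line -/

/-- The starting points of the steps of `next` that more than double the distance to a fixed
supporting line are logarithmically few. -/
theorem IsNext.card_le_of_doubling {S : Set Plane} {next : Plane → Plane} (hnext : IsNext S next)
    (hSZ : S ⊆ integerLattice) {δ : ℝ} (hδ : 1 ≤ δ) (hS : ∀ x ∈ S, ∀ y ∈ S, dist x y ≤ δ)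
    {p q c : ℝ} (hpq : p ^ 2 + q ^ 2 = 1) {h : Plane → ℝ}
    (hh : ∀ x, h x = c - (p * x 0 + q * x 1)) (hnonneg : ∀ x ∈ S, 0 ≤ h x) {T : Finset Plane}
    (hTS : ↑T ⊆ S) (hT : ∀ y ∈ T, 2 * h y < h (next y)) :
    (T.card : ℤ) ≤ 2 * ⌈Real.logb Real.goldenRatio δ⌉ + 4 := by
  have hasc : ∀ y ∈ T, h y < h (next y) := fun y hy => by
    have := hT y hy; have := hnonneg y (hTS hy); linarith
  have hinj : Set.InjOn h T := by
    intro y hy z hz he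
    by_contra hne
    have := hnext.le_of_ascending hh (hTS hy) (hTS hz) (Ne.symm hne) he.le (hasc z hz)
    have := hasc y hy
    linarith
  have hL : 0 ≤ ⌈Real.logb Real.goldenRatio δ⌉ :=
    Int.ceil_nonneg (Real.logb_nonneg Real.one_lt_goldenRatio hδ)
  obtain ⟨m, hm⟩ : ∃ m, T.card = m := ⟨_, rfl⟩
  rcases lt_or_ge m 4 with hm4 | hm4
  · rw [hm]; omega
  have hcard : (T.image h).card = m := by rw [Finset.card_image_of_injOn hinj, hm]
  have hex : ∀ k : Fin m, ∃ y ∈ T, h y = (T.image h).orderEmbOfFin hcard k := fun k =>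
    Finset.mem_image.1 (Finset.orderEmbOfFin_mem _ hcard k)
  choose y hyT hy using hex
  have hmono : ∀ {i j : Fin m}, i < j → h (y i) < h (y j) := by
    intro i j hij
    rw [hy, hy]
    exact (OrderEmbedding.strictMono _) hij
  have hstep : ∀ {i j : Fin m}, i < j → h (next (y i)) ≤ h (y j) := by
    intro i j hij
    refine hnext.le_of_ascending hh (hTS (hyT i)) (hTS (hyT j)) ?_ (hmono hij).le
      (hasc _ (hyT j))
    intro he
    have := hmono hij
    rw [he] at this
    exact lt_irrefl _ this
  set d : Fin m → ℝ := fun i => h (next (y i)) - h (y i) with hd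
  have hdh : ∀ i, h (y i) ≤ d i := fun i => by have := hT _ (hyT i); simp only [hd]; linarith
  have hdabs : ∀ i, |p * (next (y i) 0 - y i 0) + q * (next (y i) 1 - y i 1)| = d i := by
    intro i
    have hpos := hasc _ (hyT i)
    simp only [hd]
    rw [← abs_of_pos (sub_pos.2 hpos), ← abs_neg, hh, hh]
    congr 1
    ring
  have hdδ : ∀ i, d i ≤ δ := fun i => by
    rw [← hdabs]
    exact abs_coord_le_of_dist_le hpq (hS _ (hnext _ (hTS (hyT i))).1 _ (hTS (hyT i)))
  have hD : 1 ≤ δ * (d ⟨0, by omega⟩ + d ⟨1, by omega⟩) := by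
    have hne := hnext.planeDet_ne_zero hh (hTS (hyT ⟨0, by omega⟩)) (hTS (hyT ⟨1, by omega⟩))
      (fun he => by
        have := hmono (i := ⟨0, by omega⟩) (j := ⟨1, by omega⟩) (by simp)
        rw [he] at this
        exact lt_irrefl _ this) (hasc _ (hyT _)) (hasc _ (hyT _))
    have hmem := fun i => hTS (hyT i)
    refine (one_le_abs_planeDet (hSZ (hnext _ (hmem _)).1) (hSZ (hmem _))
      (hSZ (hnext _ (hmem _)).1) (hSZ (hmem _)) hne).trans ?_
    refine (abs_planeDet_le hpq (hS _ (hnext _ (hmem _)).1 _ (hmem _))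
      (hS _ (hnext _ (hmem _)).1 _ (hmem _))).trans_eq ?_
    rw [hdabs, hdabs]
  -- The increment at `k + 2` is at least its starting height, which lies above the two earlier
  -- disjoint intervals; the lowest of these starts at height at least 0.
  have hrec : ∀ k (hk : k + 2 < m),
      d ⟨k, by omega⟩ + d ⟨k + 1, by omega⟩ ≤ d ⟨k + 2, hk⟩ := by
    intro k hk
    have h1 := hdh ⟨k + 2, hk⟩
    have h2 := hstep (i := ⟨k + 1, by omega⟩) (j := ⟨k + 2, hk⟩) (by simp)
    have h3 := hstep (i := ⟨k, by omega⟩) (j := ⟨k + 1, by omega⟩) (by simp)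
    have h4 := hnonneg _ (hTS (hyT ⟨k, by omega⟩))
    simp only [hd] at *
    linarith
  have hd0 : 0 ≤ d ⟨0, by omega⟩ := (hnonneg _ (hTS (hyT _))).trans (hdh _)
  have hfib : ∀ k (hk : k + 2 < m),
      Nat.fib (k + 1) * (d ⟨0, by omega⟩ + d ⟨1, by omega⟩) ≤ d ⟨k + 2, hk⟩ := by
    intro k
    induction k using Nat.twoStepInduction with
    | zero => intro hk; simpa using hrec 0 hk
    | one =>
      intro hk
      have h1 := hrec 0 (by omega)
      have h2 := hrec 1 hk
      have h3 : (0 : ℝ) ≤ d ⟨1, by omega⟩ := (hnonneg _ (hTS (hyT _))).trans (hdh _)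
      simp only [zero_add, Nat.reduceAdd, Nat.fib_two, Nat.cast_one, one_mul] at *
      linarith
    | more k ih1 ih2 =>
      intro hk
      have h1 := ih1 (by omega)
      have h2 := ih2 (by omega)
      have h3 := hrec (k + 2) hk
      rw [show k + 2 + 1 = (k + 1) + 2 by ring, Nat.fib_add_two]
      push_cast
      rw [add_mul]
      exact (add_le_add h1 h2).trans h3
  -- The last index is then `k + 3`, where the increment is at least `Nat.fib (k + 2)` times `d 0 +
  -- d 1`.
  obtain ⟨k, rfl⟩ : ∃ k, m = k + 4 := ⟨m - 4, by omega⟩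
  have hδ0 : 0 < δ := by linarith
  have hpow : Real.goldenRatio ^ k ≤ δ ^ 2 := by
    have h1 := (hfib (k + 1) (by omega)).trans (hdδ _)
    have h2 := goldenRatio_pow_le_fib k
    have h3 : (0 : ℝ) ≤ Nat.fib (k + 2) := Nat.cast_nonneg _
    calc Real.goldenRatio ^ k ≤ Nat.fib (k + 2) := h2
      _ ≤ Nat.fib (k + 2) * (δ * (d ⟨0, by omega⟩ + d ⟨1, by omega⟩)) :=
        le_mul_of_one_le_right h3 hD
      _ = δ * (Nat.fib (k + 1 + 1) * (d ⟨0, by omega⟩ + d ⟨1, by omega⟩)) := by ring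
      _ ≤ δ * δ := by gcongr
      _ = δ ^ 2 := by ring
  have hlog : (k : ℝ) ≤ 2 * Real.logb Real.goldenRatio δ := by
    have h1 := Real.logb_le_logb_of_le Real.one_lt_goldenRatio
      (pow_pos Real.goldenRatio_pos k) hpow
    rwa [Real.logb_pow, Real.logb_pow, Real.logb_self_eq_one Real.one_lt_goldenRatio,
      mul_one] at h1
  have hk : (k : ℤ) ≤ 2 * ⌈Real.logb Real.goldenRatio δ⌉ := by
    have := Int.le_ceil (Real.logb Real.goldenRatio δ)
    have h2 : (k : ℝ) ≤ 2 * (⌈Real.logb Real.goldenRatio δ⌉ : ℝ) := by linarith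
    exact_mod_cast h2
  rw [hm]
  push_cast
  linarith

/-! ### Convex polygons as intersections of half-planes -/

/-- The points off the line through two distinct points are dense in the plane. -/
theorem dense_planeDet_ne_zero {a y : Plane} (h : a ≠ y) :
    Dense {o : Plane | planeDet (a - y) (o - y) ≠ 0} := by
  let f : Plane →L[ℝ] ℝ := (a 0 - y 0) • EuclideanSpace.proj (1 : Fin 2) -
    (a 1 - y 1) • EuclideanSpace.proj (0 : Fin 2)
  have hf : ∀ o, f o = (a 0 - y 0) * o 1 - (a 1 - y 1) * o 0 := fun o => by simp [f]
  have hne : f ≠ 0 := by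
    intro h0
    refine h (PiLp.ext fun i => ?_)
    have h1 : f (a - y) = 0 := by rw [h0]; rfl
    have h2 : f (WithLp.toLp 2 ![-(a 1 - y 1), a 0 - y 0]) = 0 := by rw [h0]; rfl
    rw [hf] at h2
    simp only [Matrix.cons_val_zero, Matrix.cons_val_one] at h2
    have h3 : a 0 - y 0 = 0 := by nlinarith [sq_nonneg (a 0 - y 0), sq_nonneg (a 1 - y 1)]
    have h4 : a 1 - y 1 = 0 := by nlinarith [sq_nonneg (a 0 - y 0), sq_nonneg (a 1 - y 1)]
    fin_cases i
    · exact sub_eq_zero.1 h3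
    · exact sub_eq_zero.1 h4
  have := (dense_compl_singleton (f y)).preimage (f.isOpenMap_of_ne_zero hne)
  convert this using 1
  ext o
  simp only [mem_ofPred_eq, mem_preimage, mem_compl_iff, mem_singleton_iff, hf, planeDet,
    PiLp.sub_apply, ne_eq, not_iff_not]
  constructor <;> intro h <;> linarith

theorem isOpen_planeDet_ne_zero (a y : Plane) :
    IsOpen {o : Plane | planeDet (a - y) (o - y) ≠ 0} := by
  refine isOpen_ne_fun ?_ continuous_const
  simp only [planeDet, PiLp.sub_apply]
  fun_prop

/-- A closed half-plane containing `P` whose boundary line, with unit normal `(p, q)`, passes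
through the distinct points `a` and `b`. -/
structure IsEdgeHalfPlane (P : Set Plane) (a b : Plane) (p q c : ℝ) : Prop where
  ne : a ≠ b
  unit : p ^ 2 + q ^ 2 = 1
  le : ∀ x ∈ P, p * x 0 + q * x 1 ≤ c
  left : p * a 0 + q * a 1 = c
  right : p * b 0 + q * b 1 = c

/-- The line determines its unit normal up to sign, and the point `o` strictly inside fixes the
sign. Hence one half-plane per edge can be chosen in advance, whatever outside point it has to
exclude. -/
theorem IsEdgeHalfPlane.unique {P : Set Plane} {a b o : Plane} {p q c p' q' c' : ℝ}
    (h : IsEdgeHalfPlane P a b p q c) (h' : IsEdgeHalfPlane P a b p' q' c') (ho : o ∈ P)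
    (hoc : p * o 0 + q * o 1 < c) : p' = p ∧ q' = q ∧ c' = c := by
  have hu := h.unit
  have hu' := h'.unit
  have h1 : p * (b 0 - a 0) + q * (b 1 - a 1) = 0 := by linarith [h.left, h.right]
  have h2 : p' * (b 0 - a 0) + q' * (b 1 - a 1) = 0 := by linarith [h'.left, h'.right]
  have hpar : p * q' = q * p' := by
    by_contra hne
    refine h.ne (PiLp.ext fun i => ?_)
    have hd : p * q' - q * p' ≠ 0 := sub_ne_zero.2 hne
    fin_cases i
    · have : (p * q' - q * p') * (b 0 - a 0) = 0 := by linear_combination q' * h1 - q * h2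
      exact (sub_eq_zero.1 ((mul_eq_zero.1 this).resolve_left hd)).symm
    · have : (p * q' - q * p') * (b 1 - a 1) = 0 := by linear_combination p * h2 - p' * h1
      exact (sub_eq_zero.1 ((mul_eq_zero.1 this).resolve_left hd)).symm
  obtain ⟨k, hk⟩ : ∃ k, k = p * p' + q * q' := ⟨_, rfl⟩
  have hp : p' = k * p := by rw [hk]; linear_combination (-p') * hu - q * hpar
  have hq : q' = k * q := by rw [hk]; linear_combination (-q') * hu + p * hpar
  have hk2 : k ^ 2 = 1 := by
    rw [hp, hq] at hu'
    linear_combination hu' - k ^ 2 * hu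
  have hc : c' = k * c := by rw [← h'.left, ← h.left, hp, hq]; ring
  rcases (sq_eq_sq_iff_eq_or_eq_neg.1 (hk2.trans (one_pow 2).symm)) with hk1 | hk1
  · simp [hp, hq, hc, hk1]
  · exfalso
    have := h'.le o ho
    rw [hp, hq, hc, hk1] at this
    linarith

/-- A point outside a convex polygon is cut off by the supporting line through some edge. -/
theorem IsConvexPolygon.exists_isEdgeHalfPlane {n : ℕ} {v : Polygon Plane n} {P : Set Plane}
    (hP : IsConvexPolygon v P) {y : Plane} (hy : y ∉ P) :
    ∃ i p q c, IsEdgeHalfPlane P (v i) (v (finRotate n i)) p q c ∧ c < p * y 0 + q * y 1 ∧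
      ∃ o ∈ P, p * o 0 + q * o 1 < c := by
  have hclosed := hP.isCompact.isClosed
  have hvP : ∀ j, v j ∈ P := fun j => hclosed.frontier_subset <| by
    rw [hP.frontier_eq]
    exact mem_iUnion.2 ⟨j, left_mem_affineSegment ℝ _ _⟩
  have hvy : ∀ j, v j ≠ y := fun j he => hy (he ▸ hvP j)
  have hdense : Dense (⋂ j, {o : Plane | planeDet (v j - y) (o - y) ≠ 0}) :=
    dense_iInter_of_isOpen (fun j => isOpen_planeDet_ne_zero _ _)
      fun j => dense_planeDet_ne_zero (hvy j)
  -- For this generic interior `o`, the segment from `o` to `y` avoids all corners, so it leaves `P`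
  -- in the relative interior of an edge.
  obtain ⟨o, ho, hov⟩ := hdense.inter_open_nonempty _ isOpen_interior hP.interior_nonempty
  simp only [mem_iInter, mem_ofPred_eq] at hov
  have hoP := interior_subset ho
  obtain ⟨b, hbseg, hbfr⟩ : (segment ℝ o y ∩ frontier P).Nonempty := by
    by_contra! h
    obtain ⟨b, -, hb, hb'⟩ := (convex_segment o y).isPreconnected (interior P) Pᶜ
      isOpen_interior hclosed.isOpen_compl
      (fun b hb => by
        by_contra hbu
        rw [mem_union, not_or, mem_compl_iff, not_not] at hbu
        exact notMem_empty b (h ▸ ⟨hb, subset_closure hbu.2, hbu.1⟩))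
      ⟨o, left_mem_segment ℝ _ _, ho⟩ ⟨y, right_mem_segment ℝ _ _, hy⟩
    exact hb' (interior_subset hb)
  have hbP : b ∈ P := hclosed.frontier_subset hbfr
  obtain ⟨s, t, hs, ht, hst, rfl⟩ := hbseg
  have hbv : ∀ j, v j ≠ s • o + t • y := fun j he => hov j <| by
    rw [he]
    simp only [planeDet, PiLp.sub_apply, PiLp.add_apply, PiLp.smul_apply, smul_eq_mul]
    obtain rfl : t = 1 - s := by linarith
    ring
  have hs0 : 0 < s := by
    refine lt_of_le_of_ne hs fun h0 => hy ?_
    have : t = 1 := by linarith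
    simpa [← h0, this] using hbP
  obtain ⟨f, hf⟩ := geometric_hahn_banach_open_point hP.convex.interior isOpen_interior
    hbfr.2
  obtain ⟨p, q, hpq⟩ := exists_apply_eq_coords f
  have hfo := hf o ho
  have hfle : ∀ x ∈ P, f x ≤ f (s • o + t • y) := by
    intro x hx
    have hx' : x ∈ closure (interior P) := by
      rw [hP.convex.closure_interior_eq_closure_of_nonempty_interior hP.interior_nonempty]
      exact subset_closure hx
    exact closure_minimal (fun z hz => (hf z hz).le)
      (isClosed_le f.continuous continuous_const) hx'
  have hbe := hbfr
  rw [hP.frontier_eq] at hbe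
  obtain ⟨i, τ, ⟨hτ0, hτ1⟩, hτ⟩ := mem_iUnion.1 hbe
  have hτ0' : 0 < τ := lt_of_le_of_ne hτ0 fun h0 => hbv i <| by
    rw [← hτ, ← h0, AffineMap.lineMap_apply_zero]
  have hτ1' : τ < 1 := lt_of_le_of_ne hτ1 fun h0 => hbv (finRotate n i) <| by
    rw [← hτ, h0, AffineMap.lineMap_apply_one]
  have hne : v i ≠ v (finRotate n i) := fun he => hbv i <| by
    rw [← hτ, ← he, AffineMap.lineMap_same_apply]
  have hfτ : (1 - τ) * f (v i) + τ * f (v (finRotate n i)) = f (s • o + t • y) := by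
    rw [← hτ, AffineMap.lineMap_apply_module]
    simp
  have hva := hfle _ (hvP i)
  have hvb := hfle _ (hvP (finRotate n i))
  have hfy : f (s • o + t • y) < f y := by
    have h1 : f (s • o + t • y) = s * f o + t * f y := by simp
    by_contra! h
    have h2 := mul_pos hs0 (sub_pos.2 hfo)
    have h3 := mul_nonneg ht (sub_nonneg.2 h)
    have h4 : (s + t) * f (s • o + t • y) = f (s • o + t • y) := by rw [hst, one_mul]
    linarith
  -- On the edge, `f` is affine and reaches its maximum at an interior point, so it is constant
  -- there.
  have heqa : f (v i) = f (s • o + t • y) := by nlinarith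
  have heqb : f (v (finRotate n i)) = f (s • o + t • y) := by nlinarith
  generalize s • o + t • y = b at *
  have hr0 : 0 < p ^ 2 + q ^ 2 := by
    by_contra h
    have hp : p = 0 := by nlinarith [sq_nonneg p, sq_nonneg q]
    have hq : q = 0 := by nlinarith [sq_nonneg p, sq_nonneg q]
    simp [hpq, hp, hq] at hfo
  set r := √(p ^ 2 + q ^ 2) with hr
  have hrpos : 0 < r := Real.sqrt_pos.2 hr0
  have hscale : ∀ x : Plane, p / r * x 0 + q / r * x 1 = f x / r := fun x => by
    rw [hpq]; ring
  refine ⟨i, p / r, q / r, f b / r, ⟨hne, ?_, fun x hx => ?_, ?_, ?_⟩, ?_, o, hoP, ?_⟩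
  · rw [div_pow, div_pow, ← add_div, hr, Real.sq_sqrt hr0.le, div_self hr0.ne']
  · rw [hscale]; exact div_le_div_of_nonneg_right (hfle x hx) hrpos.le
  · rw [hscale, heqa]
  · rw [hscale, heqb]
  · rw [hscale]; exact div_lt_div_of_pos_right hfy hrpos
  · rw [hscale]; exact div_lt_div_of_pos_right hfo hrpos

/-- A convex polygon with `n` edges is an intersection of `n` closed half-planes. -/
theorem IsConvexPolygon.exists_halfPlanes {n : ℕ} {v : Polygon Plane n} {P : Set Plane}
    (hP : IsConvexPolygon v P) :
    ∃ p q c : Fin n → ℝ, (∀ i, p i ^ 2 + q i ^ 2 = 1) ∧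
      (∀ i, ∀ x ∈ P, p i * x 0 + q i * x 1 ≤ c i) ∧
      ∀ y ∉ P, ∃ i, c i < p i * y 0 + q i * y 1 := by
  have key : ∀ i : Fin n, ∃ p q c : ℝ, p ^ 2 + q ^ 2 = 1 ∧ (∀ x ∈ P, p * x 0 + q * x 1 ≤ c) ∧
      ((∃ p q c, IsEdgeHalfPlane P (v i) (v (finRotate n i)) p q c) →
        IsEdgeHalfPlane P (v i) (v (finRotate n i)) p q c) := by
    intro i
    by_cases h : ∃ p q c, IsEdgeHalfPlane P (v i) (v (finRotate n i)) p q c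
    · obtain ⟨p, q, c, h⟩ := h
      exact ⟨p, q, c, h.unit, h.le, fun _ => h⟩
    -- An edge without a supporting half-plane never cuts off a point, so any half-plane containing
    -- `P` will do.
    · obtain ⟨R, hR⟩ := hP.isCompact.isBounded.exists_norm_le
      refine ⟨1, 0, R, by norm_num, fun x hx => ?_, fun h' => absurd h' h⟩
      have h1 : |x 0| ≤ R := (PiLp.norm_apply_le x 0).trans (hR x hx)
      simpa using (le_abs_self _).trans h1
  choose p q c hunit hle hedge using key
  refine ⟨p, q, c, hunit, hle, fun y hy => ?_⟩
  obtain ⟨i, p', q', c', h, hyc, o, ho, hoc⟩ := hP.exists_isEdgeHalfPlane hy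
  obtain ⟨h1, h2, h3⟩ := h.unique (hedge i ⟨p', q', c', h⟩) ho hoc
  exact ⟨i, by rw [h1, h2, h3]; exact hyc⟩

/-! ### Reflection argument and summation over the edges -/

theorem two_mul_sub_mem_integerLattice {x y : Plane} (hx : x ∈ integerLattice)
    (hy : y ∈ integerLattice) : (2 : ℝ) • y - x ∈ integerLattice := by
  intro i
  obtain ⟨a, ha⟩ := hx i
  obtain ⟨b, hb⟩ := hy i
  exact ⟨2 * b - a, by simp [ha, hb]⟩

theorem mainTheorem7 (n : ℕ) (v : Polygon Plane n) (P : Set Plane) (hP : IsConvexPolygon v P)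
    (hdiam : Real.goldenRatio ^ (-4 : ℤ) < Metric.diam P) :
    (discreteHullVertices P).Finite ∧
      ((discreteHullVertices P).ncard : ℤ) ≤
        (2 * ⌈Real.logb Real.goldenRatio (Metric.diam P)⌉ + 7) * (n : ℤ) := by
  classical
  have hbdd := hP.isCompact.isBounded
  have hVsub : discreteHullVertices P ⊆ P ∩ integerLattice := extremePoints_convexHull_subset
  have hVfin : (discreteHullVertices P).Finite := (finite_inter_integerLattice hbdd).subset hVsub
  refine ⟨hVfin, ?_⟩
  obtain ⟨p, q, c, hunit, hle, hout⟩ := hP.exists_halfPlanes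
  have hn : 1 ≤ (n : ℤ) := by
    obtain ⟨y, hy⟩ : ∃ y, y ∉ P := by
      by_contra! h
      rw [eq_univ_of_forall h] at hbdd
      exact NormedSpace.unbounded_univ ℝ Plane hbdd
    obtain ⟨i, -⟩ := hout y hy
    have := i.pos
    omega
  -- This makes the factor `2⌈log_φ δ⌉ + 7` at least 1, which settles the case of at most one
  -- vertex.
  have hL : -3 ≤ ⌈Real.logb Real.goldenRatio (Metric.diam P)⌉ := by
    have h1 : (-4 : ℝ) < Real.logb Real.goldenRatio (Metric.diam P) := by
      rw [Real.lt_logb_iff_rpow_lt Real.one_lt_goldenRatio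
        ((zpow_pos Real.goldenRatio_pos _).trans hdiam)]
      rw [← Real.rpow_intCast] at hdiam
      exact_mod_cast hdiam
    have : (-4 : ℤ) < ⌈Real.logb Real.goldenRatio (Metric.diam P)⌉ :=
      Int.lt_ceil.2 (by push_cast; exact h1)
    omega
  rcases le_or_gt (discreteHullVertices P).ncard 1 with hcard | hcard
  · have : ((discreteHullVertices P).ncard : ℤ) ≤ 1 := by exact_mod_cast hcard
    nlinarith
  have hnontriv : ∀ y ∈ discreteHullVertices P, ∃ z ∈ discreteHullVertices P, z ≠ y := by
    intro y _
    exact Set.exists_ne_of_one_lt_ncard hcard y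
  have hK : Convex ℝ (discreteHull P) := convex_convexHull ℝ _
  have hdist : ∀ x ∈ discreteHullVertices P, ∀ y ∈ discreteHullVertices P,
      dist x y ≤ Metric.diam P := fun x hx y hy =>
    Metric.dist_le_diam_of_mem hbdd (hVsub hx).1 (hVsub hy).1
  have hdiam1 : 1 ≤ Metric.diam P := by
    obtain ⟨x, hx, y, hy, hxy⟩ := (Set.one_lt_ncard hVfin).1 hcard
    exact (one_le_dist_of_mem_integerLattice (hVsub hx).2 (hVsub hy).2 hxy).trans (hdist x hx y hy)
  have hex : ∀ y, ∃ z, y ∈ discreteHullVertices P → z ∈ discreteHullVertices P ∧ z ≠ y ∧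
      ∀ w ∈ discreteHullVertices P, w ≠ y → w ≠ z → 0 < planeDet (z - y) (w - y) := by
    intro y
    by_cases hy : y ∈ discreteHullVertices P
    · obtain ⟨z, hz⟩ := exists_counterclockwise_next hK subset_rfl hVfin hy (hnontriv y hy)
      exact ⟨z, fun _ => hz⟩
    · exact ⟨y, fun h => absurd h hy⟩
  choose next hnext using hex
  have hnext' : IsNext (discreteHullVertices P) next := hnext
  set T : Fin n → Finset Plane := fun i => hVfin.toFinset.filter fun y =>
    2 * (c i - (p i * y 0 + q i * y 1)) < c i - (p i * next y 0 + q i * next y 1) with hT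
  have hcover : hVfin.toFinset ⊆ Finset.univ.biUnion T := by
    intro y hy
    have hyV := hVfin.mem_toFinset.1 hy
    obtain ⟨hzV, hzy, -⟩ := hnext y hyV
    -- The vertex `y` is the midpoint of `next y` and this reflected lattice point.
    have hrefl : (2 : ℝ) • y - next y ∉ P := by
      intro hmem
      have hmem' : (2 : ℝ) • y - next y ∈ discreteHull P := subset_convexHull ℝ _
        ⟨hmem, two_mul_sub_mem_integerLattice (hVsub hzV).2 (hVsub hyV).2⟩
      refine hzy ((mem_extremePoints.1 hyV).2 _ hmem' _ hzV.1 ?_).2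
      refine ⟨1 / 2, 1 / 2, by norm_num, by norm_num, by norm_num, ?_⟩
      module
    obtain ⟨i, hi⟩ := hout _ hrefl
    refine Finset.mem_biUnion.2 ⟨i, Finset.mem_univ i, Finset.mem_filter.2 ⟨hy, ?_⟩⟩
    simp only [PiLp.sub_apply, PiLp.smul_apply, smul_eq_mul] at hi
    linarith
  have hTcard : ∀ i, ((T i).card : ℤ) ≤
      2 * ⌈Real.logb Real.goldenRatio (Metric.diam P)⌉ + 4 := fun i =>
    hnext'.card_le_of_doubling (fun x hx => (hVsub hx).2) hdiam1 hdist (hunit i)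
      (h := fun x => c i - (p i * x 0 + q i * x 1)) (fun _ => rfl)
      (fun x hx => sub_nonneg.2 (hle i x (hVsub hx).1))
      (fun x hx => hVfin.mem_toFinset.1 (Finset.mem_filter.1 hx).1)
      (fun y hy => (Finset.mem_filter.1 hy).2)
  rw [Set.ncard_eq_toFinset_card _ hVfin]
  calc (hVfin.toFinset.card : ℤ) ≤ ∑ i, ((T i).card : ℤ) := by
        exact_mod_cast (Finset.card_le_card hcover).trans Finset.card_biUnion_le
    _ ≤ ∑ _i : Fin n, (2 * ⌈Real.logb Real.goldenRatio (Metric.diam P)⌉ + 4) :=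
        Finset.sum_le_sum fun i _ => hTcard i
    _ = (2 * ⌈Real.logb Real.goldenRatio (Metric.diam P)⌉ + 4) * n := by
        simp [mul_comm]
    _ ≤ _ := by nlinarith
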